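/- Let $O\ge 1$, $S\ge 2$, $L\ge 1$ be integers. Let $P_L^{O,S}$ be the arrow-of-time polytope: the set of all families $p(a_1\ldots a_L|x_1\ldots x_L)$ with $O$ possible outputs $a_i$ and $S$ possible inputs $x_i$ that are nonnegative, normalized ($\sum_{a}p(a|x)=1$ for every $x$), and such that for every $k$ the marginal of $a_1,\ldots,a_k$ depends only on $x_1,\ldots,x_k$. A tree $\Gamma$ assigns to each node $(x_1,\ldots,x_{l-1})$ of time-step $l\in\{1,\ldots,L\}$ a tuple in $\{0,\ldots,O-1\}^S$, the outputs for the $S$ possible next inputs, and it defines a deterministic correlation in $P_L^{O,S}$; the future of a node is the subtree of tuples rooted at it, up to time-step $L$. A correlation $p$ is realizable in dimension $d$ if there are a density operator $\rho$ on $\mathbb C^d$ and time-independent quantum instruments $\{\mathcal I_{a|x}\}_a$ (completely positive maps on the operators on $\mathbb C^d$ with $\sum_a\mathcal I_{a|x}(1)=1$ for each $x$) such that $p(a_1\ldots a_L|x_1\ldots x_L)=\mathrm{tr}[\rho\,\mathcal I_{a_1|x_1}\circ\cdots\circ\mathcal I_{a_L|x_L}(1)]$ for all inputs and outputs. The minimal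 dimension of $p$ is the least such $d$ ($\infty$ if there is none), and $d_{\min}=d_{\min}(L,O,S)$ is the supremum of the minimal dimensions of the extreme points of $P_L^{O,S}$. Let $W$ denote the principal branch of the Lambert function, and let $$z_L=\frac{S^L\,O^{S/(S-1)}\ln O}{S-1},\qquad D_L=\frac{O^{-2S/(S-1)}S^L\ln O}{S-1}\,(\ln z_L)^{-1+\frac1{2\ln z_L}} .$$ 1. There is a largest integer $j$ with $S^{j-1}\le O^{\frac{S^{L-j+2}-S}{S-1}}$; it satisfies $1\le j\le L$ and $$j=\left\lfloor \frac{1}{\ln S}\,W\!\left[\frac{S^{L+1}}{S-1}\,(\log_S O)\,S^{\frac{S}{S-1}\log_S O}\ln S\right]-\frac{S}{S-1}\log_S O+1\right\rfloor .$$ 2. For this $j$ there is a tree $\Gamma$ whose deterministic correlation is an extreme point of $P_L^{O,S}$ and whose $S^{j-1}$ nodes of time-step $j$ have pairwise different futures; its minimal dimension is finite and at least $S^{j-1}$. Hence $d_{\min}\ge S^{j-1}$. 3. If $z_L\ge e$, then $d_{\min}\ge S^{m-2}$ for every $m\in\mathbb R$ with $S^{m-2}\le D_L$. 4. Let $O\ge2$,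 and fix $O$ and $S$. There are constants $A,B,\alpha>0$ and $\delta\in\mathbb R$, depending only on $O$ and $S$, such that with $\beta=\ln S$ and $\gamma=1$ $$D_L=A\,S^{L-1}\,(\ln[BS^L])^{-1+(2\ln[BS^L])^{-1}}\ \ (L\ge 1),\qquad D_L=\alpha\,e^{\beta L+(\frac{\delta}{L}-\gamma)\ln L}\,\bigl(1+O(1/L)\bigr)\ \ (L\to\infty).$$ In particular, $d_{\min}$ grows at least exponentially in $L$ up to logarithmic corrections: there is $c>0$, depending only on $O$ and $S$, with $d_{\min}\ge c\,e^{L\ln S}/L$ for all $L\ge1$. -/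

import Mathlib

open scoped CStarAlgebra ENNReal Asymptotics

noncomputable section

namespace TemporalCorr

/-! ### The arrow-of-time polytope -/

/-- A family of numbers `p x a = p(a₁ … a_L | x₁ … x_L)`, for sequences of `L` inputs with `S`
possible values and sequences of `L` outputs with `O` possible values. -/
abbrev Correlation (L O S : ℕ) : Type := (Fin L → Fin S) → (Fin L → Fin O) → ℝ

/-- The marginal `p(b₁ … b_k | x₁ … x_L)` of the first `k` outputs; only the first `k` entries
of `b` matter. -/
def marginal {L O S : ℕ} (p : Correlation L O S) (k : ℕ) (x : Fin L → Fin S)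
    (b : Fin L → Fin O) : ℝ :=
  ∑ a : Fin L → Fin O with ∀ i : Fin L, (i : ℕ) < k → a i = b i, p x a

/-- The arrow-of-time polytope `P_L^{O,S}`: nonnegativity, normalization, and the condition that
the distribution of the first `k` outputs depends on the first `k` inputs only. -/
def aotPolytope (L O S : ℕ) : Set (Correlation L O S) :=
  {p | (∀ x a, 0 ≤ p x a) ∧
    (∀ x, ∑ a, p x a = 1) ∧
    (∀ k : ℕ, k ≤ L → ∀ x x' : Fin L → Fin S, (∀ i : Fin L, (i : ℕ) < k → x i = x' i) →
      ∀ b, marginal p k x b = marginal p k x' b)}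

/-! ### Trees of output tuples -/

/-- An assignment of output tuples to the nodes of the `S`-ary tree. The node that is reached
from the root by the inputs `h = [x₁, …, x_{l-1}]` belongs to time-step `l = h.length + 1` and
carries the tuple `Γ h = (z_1, …, z_S)`, where `z_x` is the output for the next input `x`.
For sequences of length `L` only the nodes with `h.length < L` play a role. -/
abbrev TupleTree (O S : ℕ) : Type := List (Fin S) → Fin S → Fin O

/-- The nodes `h` and `h'` have the same `r`-length future: the tuples at the two nodes agree, and
so do those at all corresponding descendants up to `r` time-steps later. -/
def TupleTree.SameFuture {O S : ℕ} (Γ : TupleTree O S) (r : ℕ) (h h' : List (Fin S)) : Prop :=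
  ∀ w : List (Fin S), w.length ≤ r → Γ (h ++ w) = Γ (h' ++ w)

/-- For sequences of length `L`, the `S ^ (j - 1)` nodes of time-step `j` have pairwise different
futures (these have length `L - j`). -/
def TupleTree.DistinctFuturesAt {O S : ℕ} (Γ : TupleTree O S) (L j : ℕ) : Prop :=
  ∀ h h' : List (Fin S), h.length = j - 1 → h'.length = j - 1 →
    Γ.SameFuture (L - j) h h' → h = h'

/-- The deterministic correlation of length `L` given by a tree: the `i`-th output is the one
which the node reached by the earlier inputs assigns to the `i`-th input. -/
def TupleTree.correlation {O S : ℕ} (Γ : TupleTree O S) (L : ℕ) : Correlation L O S :=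
  fun x a => if ∀ i : Fin L, a i = Γ ((List.ofFn x).take i) (x i) then 1 else 0

/-! ### Quantum realizations with time-independent instruments -/

/-- Operators on the Hilbert space `ℂ^d`, with Mathlib's C⋆-algebra structure and Loewner order. -/
abbrev Op (d : ℕ) : Type := EuclideanSpace ℂ (Fin d) →L[ℂ] EuclideanSpace ℂ (Fin d)

/-- The trace of an operator. -/
def tr {d : ℕ} (A : Op d) : ℂ := LinearMap.trace ℂ (EuclideanSpace ℂ (Fin d)) A.toLinearMap

/-- A `d`-dimensional quantum machine: an initial density operator and, for each input, a quantum
instrument in the Heisenberg picture. The same instruments are used at all time-steps. -/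
structure QuantumMachine (d O S : ℕ) where
  /-- the initial state -/
  ρ : Op d
  ρ_nonneg : 0 ≤ ρ
  tr_ρ : tr ρ = 1
  /-- `instr x a` is the completely positive map for input `x` and outcome `a` -/
  instr : Fin S → Fin O → (Op d →CP Op d)
  unital : ∀ x, ∑ a, instr x a 1 = 1

/-- The effect `I_{a₁|x₁} ∘ ⋯ ∘ I_{aₙ|xₙ} (1)` of a sequence `[(x₁, a₁), …, (xₙ, aₙ)]`. -/
def QuantumMachine.effect {d O S : ℕ} (M : QuantumMachine d O S) (s : List (Fin S × Fin O)) :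
    Op d :=
  s.foldr (fun xa E => M.instr xa.1 xa.2 E) 1

/-- `p` is obtained in dimension `d`:
`p(a₁ … a_L | x₁ … x_L) = tr[ρ I_{a₁|x₁} ∘ ⋯ ∘ I_{a_L|x_L} (1)]` for some `d`-dimensional quantum
machine. -/
def Realizable {L O S : ℕ} (d : ℕ) (p : Correlation L O S) : Prop :=
  ∃ M : QuantumMachine d O S, ∀ x a,
    (p x a : ℂ) = tr (M.ρ * M.effect (List.ofFn fun i => (x i, a i)))

/-- The minimal dimension needed to obtain `p` (`⊤` if no finite dimension suffices). -/
def minDim {L O S : ℕ} (p : Correlation L O S) : ℕ∞ :=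
  ⨅ (d : ℕ) (_ : Realizable d p), (d : ℕ∞)

/-- The dimension needed to reach every extreme point of `P_L^{O,S}`: the supremum of the minimal
dimensions of the extreme points. -/
def dMin (L O S : ℕ) : ℕ∞ :=
  ⨆ p ∈ Set.extremePoints ℝ (aotPolytope L O S), minDim p

/-! ### The closed-form bounds -/

/-- The principal branch of the Lambert function: for `x ≥ -1/e`, `lambertW x` is the unique
`w ≥ -1` with `w e^w = x`. -/
def lambertW (x : ℝ) : ℝ :=
  Function.invFunOn (fun w : ℝ => w * Real.exp w) (Set.Ici (-1)) x

/-- `z(L) = S^L O^{S/(S-1)} ln O / (S-1)`. -/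
def zArg (O S L : ℕ) : ℝ :=
  (S : ℝ) ^ L * (O : ℝ) ^ ((S : ℝ) / ((S : ℝ) - 1)) * Real.log O / ((S : ℝ) - 1)

/-- `O^{-2S/(S-1)} S^L ln O / (S-1) * (ln z)^{-1 + 1/(2 ln z)}` with `z = z(L)`. -/
def dimBound (O S L : ℕ) : ℝ :=
  (O : ℝ) ^ (-(2 * (S : ℝ) / ((S : ℝ) - 1))) * (S : ℝ) ^ L * Real.log O / ((S : ℝ) - 1) *
    Real.log (zArg O S L) ^ (-1 + (2 * Real.log (zArg O S L))⁻¹)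

end TemporalCorr

end

/-! Dimension bound (`le_of_realizable`): a machine that reproduces a deterministic tree assigns to
each node of time-step `j` a positive functional, the unnormalized state after the path to that
node. Its value at 1 is in fact 1. If two futures differ, the outputs along a suitable continuation
form an effect with value 1 on one functional and 0 on the other. Such functionals yield nonzero,
pairwise orthogonal vectors (`card_le_of_distinguishable`), so `S ^ (j - 1) ≤ d`. Finiteness comes
from an automaton that remembers the whole input history.

Existence of the tree is counting: a node of time-step `j` has `(O ^ S) ^ (1 + S + ⋯ + S ^ (L - j))`
possible futures, so admissibility of `j` allows an injection from nodes to futures.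

Closed forms: put `u = O ^ (S / (S - 1))` and `y = (i - 1) ln S + ln u`. Admissibility of `i`
becomes `y e^y ≤ S z_L` (`mem_admissible_iff`), which gives the Lambert formula. Failure at `j + 1`
gives `S ^ (j - 1) ≥ S ^ (L - 1) ln u / ln (S z_L)` by elementary means (`le_pow_of_isGreatest`);
both the bound `D_L` and the growth rate follow from this. -/

namespace TemporalCorr

variable {L O S d : ℕ}

/-! ### Paths in a tree -/

/-- The inputs and outputs along the path that leaves the node `h` with the inputs `v`. -/
def TupleTree.run (Γ : TupleTree O S) (h : List (Fin S)) :
    List (Fin S) → List (Fin S × Fin O)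
  | [] => []
  | x :: v => (x, Γ h x) :: TupleTree.run Γ (h ++ [x]) v

@[simp]
theorem TupleTree.length_run (Γ : TupleTree O S) (h v : List (Fin S)) :
    (Γ.run h v).length = v.length := by
  induction v generalizing h with
  | nil => rfl
  | cons x v ih => simp [TupleTree.run, ih]

@[simp]
theorem TupleTree.map_fst_run (Γ : TupleTree O S) (h v : List (Fin S)) :
    (Γ.run h v).map Prod.fst = v := by
  induction v generalizing h with
  | nil => rfl
  | cons x v ih => simp [TupleTree.run, ih]

theorem TupleTree.run_append (Γ : TupleTree O S) (h v w : List (Fin S)) :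
    Γ.run h (v ++ w) = Γ.run h v ++ Γ.run (h ++ v) w := by
  induction v generalizing h with
  | nil => simp [TupleTree.run]
  | cons x v ih => simp [TupleTree.run, ih]

theorem TupleTree.getElem_run (Γ : TupleTree O S) (h v : List (Fin S)) (i : ℕ)
    (hi : i < (Γ.run h v).length) :
    (Γ.run h v)[i] = (v[i]'(by simpa using hi), Γ (h ++ v.take i) (v[i]'(by simpa using hi))) := by
  induction v generalizing h i with
  | nil => simp [TupleTree.run] at hi
  | cons x v ih =>
    cases i with
    | zero => simp [TupleTree.run]
    | succ i => simp [TupleTree.run, ih]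

theorem TupleTree.correlation_eq (Γ : TupleTree O S) (x : Fin L → Fin S) (a : Fin L → Fin O) :
    Γ.correlation L x a =
      if (List.ofFn fun i => (x i, a i)) = Γ.run [] (List.ofFn x) then 1 else 0 := by
  unfold TupleTree.correlation
  congr 1
  rw [eq_iff_iff]
  constructor
  · intro h
    apply List.ext_getElem (by simp)
    intro i h1 h2
    simp at h1
    simp [TupleTree.getElem_run, h ⟨i, h1⟩]
  · intro h i
    have h1 : (i : ℕ) < (List.ofFn fun i => (x i, a i)).length := by simp
    have := List.getElem_of_eq h h1
    simp [TupleTree.getElem_run] at this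
    exact this

/-! ### Operators -/

/-- With `A = R* R`, cyclicity turns the trace into that of the positive operator `R B R*`. -/
theorem tr_mul_nonneg {A B : Op d} (hA : 0 ≤ A) (hB : 0 ≤ B) : 0 ≤ (tr (A * B)).re := by
  obtain ⟨R, rfl⟩ := CStarAlgebra.nonneg_iff_eq_star_mul_self.mp hA
  have h1 : tr (star R * R * B) = tr (R * B * star R) := by
    have := LinearMap.trace_mul_comm ℂ (star R).toLinearMap (R * B).toLinearMap
    unfold tr
    rw [mul_assoc]
    exact this
  have h2 : 0 ≤ R * B * star R := star_right_conjugate_nonneg hB R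
  rw [h1]
  rw [ContinuousLinearMap.nonneg_iff_isPositive, ← ContinuousLinearMap.isPositive_toLinearMap_iff]
    at h2
  exact (RCLike.nonneg_iff.mp h2.trace_nonneg).1

theorem tr_sub (A B : Op d) : tr (A - B) = tr A - tr B := by
  simp [tr]

/-- The composition `I_{a₁|x₁} ∘ ⋯ ∘ I_{aₙ|xₙ}` for the sequence `s = [(x₁, a₁), …, (xₙ, aₙ)]`. -/
noncomputable def QuantumMachine.step (M : QuantumMachine d O S) (s : List (Fin S × Fin O)) : Op d →ₗ[ℂ] Op d :=
  s.foldr (fun xa T => (M.instr xa.1 xa.2).toLinearMap ∘ₗ T) LinearMap.id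

theorem _root_.CompletelyPositiveMap.apply_mono {A : Type*} [NonUnitalCStarAlgebra A]
    [PartialOrder A] [StarOrderedRing A] (f : A →CP A) {a b : A} (h : a ≤ b) : f a ≤ f b :=
  OrderHomClass.mono f h

theorem QuantumMachine.instr_mono (M : QuantumMachine d O S) (x : Fin S) (a : Fin O) {A B : Op d}
    (h : A ≤ B) : M.instr x a A ≤ M.instr x a B :=
  (M.instr x a).apply_mono h

theorem QuantumMachine.instr_nonneg (M : QuantumMachine d O S) (x : Fin S) (a : Fin O) {A : Op d}
    (h : 0 ≤ A) : 0 ≤ M.instr x a A := by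
  have := M.instr_mono x a h
  rwa [map_zero] at this

theorem QuantumMachine.instr_one_le (M : QuantumMachine d O S) (x : Fin S) (a : Fin O) :
    M.instr x a 1 ≤ 1 := by
  refine le_of_le_of_eq ?_ (M.unital x)
  exact Finset.single_le_sum (f := fun a => M.instr x a 1)
    (fun b _ => M.instr_nonneg x b zero_le_one) (Finset.mem_univ a)

theorem QuantumMachine.step_nonneg (M : QuantumMachine d O S) (s : List (Fin S × Fin O)) {E : Op d}
    (h : 0 ≤ E) : 0 ≤ M.step s E := by
  induction s with
  | nil => exact h
  | cons xa s ih => exact M.instr_nonneg _ _ ih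

theorem QuantumMachine.effect_eq_step (M : QuantumMachine d O S) (s : List (Fin S × Fin O)) :
    M.effect s = M.step s 1 := by
  induction s with
  | nil => rfl
  | cons xa s ih =>
    change M.instr _ _ (M.effect s) = M.instr _ _ (M.step s 1)
    rw [ih]

theorem QuantumMachine.effect_append (M : QuantumMachine d O S) (s t : List (Fin S × Fin O)) :
    M.effect (s ++ t) = M.step s (M.effect t) := by
  induction s with
  | nil => rfl
  | cons xa s ih =>
    change M.instr _ _ (M.effect (s ++ t)) = M.instr _ _ (M.step s (M.effect t))
    rw [ih]

theorem QuantumMachine.effect_nonneg (M : QuantumMachine d O S) (s : List (Fin S × Fin O)) :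
    0 ≤ M.effect s := by
  rw [M.effect_eq_step]
  exact M.step_nonneg s zero_le_one

theorem QuantumMachine.effect_le_one (M : QuantumMachine d O S) (s : List (Fin S × Fin O)) :
    M.effect s ≤ 1 := by
  induction s with
  | nil => exact le_rfl
  | cons xa s ih => exact (M.instr_mono _ _ ih).trans (M.instr_one_le _ _)

/-! ### Different futures force a large dimension -/

theorem Realizable.exists_machine {Γ : TupleTree O S} (h : Realizable d (Γ.correlation L)) :
    ∃ M : QuantumMachine d O S, ∀ s : List (Fin S × Fin O), s.length = L →
      tr (M.ρ * M.effect s) = if s = Γ.run [] (s.map Prod.fst) then 1 else 0 := by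
  obtain ⟨M, hM⟩ := h
  refine ⟨M, ?_⟩
  rintro s rfl
  have := hM (fun i => (s.get i).1) (fun i => (s.get i).2)
  rw [TupleTree.correlation_eq] at this
  have e1 : (List.ofFn fun i => ((s.get i).1, (s.get i).2)) = s := List.ofFn_get s
  have e2 : (List.ofFn fun i => (s.get i).1) = s.map Prod.fst := by
    apply List.ext_getElem <;> simp
  rw [e1, e2] at this
  rw [← this]
  split_ifs <;> simp

/-- If the sum `E` of the `G i` were invertible, then `E ≥ r • 1` with `r > 0`, and `φ E` would have
positive real part. So `E` has a kernel vector, and positivity of the summands forces each of them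
to kill it. -/
theorem exists_ne_zero_apply_eq_zero {ι : Type*} (s : Finset ι) (G : ι → Op d)
    (hG : ∀ i, 0 ≤ G i) (φ : Op d →ₗ[ℂ] ℂ) (hφ : ∀ E, 0 ≤ E → 0 ≤ (φ E).re)
    (h1 : 0 < (φ 1).re) (h0 : ∀ i ∈ s, (φ (G i)).re = 0) :
    ∃ v : EuclideanSpace ℂ (Fin d), v ≠ 0 ∧ ∀ i ∈ s, G i v = 0 := by
  set E := ∑ i ∈ s, G i with hE
  have hE0 : 0 ≤ E := Finset.sum_nonneg fun i _ => hG i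
  have hφE : (φ E).re = 0 := by rw [hE, map_sum, Complex.re_sum]; exact Finset.sum_eq_zero h0
  have hv : ∃ v : EuclideanSpace ℂ (Fin d), v ≠ 0 ∧ E v = 0 := by
    by_contra! hcon
    have hu : IsUnit E := by
      rw [ContinuousLinearMap.isUnit_iff_isUnit_toLinearMap, LinearMap.isUnit_iff_ker_eq_bot,
        LinearMap.ker_eq_bot']
      intro v hv
      by_contra hne
      exact hcon v hne hv
    have hsp : IsStrictlyPositive E := hu.isStrictlyPositive hE0
    rcases subsingleton_or_nontrivial (Op d) with hs | hs
    · rw [Subsingleton.elim (1 : Op d) 0] at h1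
      simp at h1
    obtain ⟨r, hr, hle⟩ := (CFC.exists_pos_algebraMap_le_iff hsp.isSelfAdjoint).2
      fun x hx => hsp.spectrum_pos hx
    have := hφ _ (sub_nonneg.mpr hle)
    rw [map_sub, Complex.sub_re, hφE, Algebra.algebraMap_eq_smul_one] at this
    have e : (r • (1 : Op d)) = (r : ℂ) • 1 := by ext; simp
    rw [e, map_smul] at this
    simp at this
    nlinarith
  obtain ⟨v, hv0, hv⟩ := hv
  refine ⟨v, hv0, fun i hi => ?_⟩
  have hi0 : 0 ≤ G i := hG i
  have hsum : ∑ i ∈ s, (inner ℂ (G i v) v).re = 0 := by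
    have : (inner ℂ (E v) v) = 0 := by rw [hv]; simp
    rw [hE, sum_apply, sum_inner] at this
    rw [← Complex.re_sum, this]; rfl
  have hz := (Finset.sum_eq_zero_iff_of_nonneg (fun j _ =>
    ((ContinuousLinearMap.nonneg_iff_isPositive _).mp (hG j)).re_inner_nonneg_left v)).mp hsum i hi
  obtain ⟨R, hR⟩ := CStarAlgebra.nonneg_iff_eq_star_mul_self.mp hi0
  rw [hR] at hz ⊢
  have h2 : (inner ℂ (R v) (R v)).re = 0 := by
    rw [← hz, ContinuousLinearMap.star_eq_adjoint, mul_apply_eq_comp,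
      ContinuousLinearMap.adjoint_inner_left]
    rfl
  have h3 : R v = 0 := by
    rw [← inner_self_eq_zero (𝕜 := ℂ), ← inner_self_ofReal_re (𝕜 := ℂ)]
    simpa using h2
  simp [h3]

/-- Positive functionals which are pairwise perfectly distinguishable are at most as many as the
dimension. -/
theorem card_le_of_distinguishable {ι : Type*} [Fintype ι] (φ : ι → Op d →ₗ[ℂ] ℂ)
    (hφ : ∀ i E, 0 ≤ E → 0 ≤ (φ i E).re) (h1 : ∀ i, (φ i 1).re = 1)
    (F : ι → ι → Op d) (hF0 : ∀ i j, 0 ≤ F i j) (hF1 : ∀ i j, F i j ≤ 1)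
    (hF : ∀ i j, i ≠ j → φ i (F i j) = 1 ∧ φ j (F i j) = 0) : Fintype.card ι ≤ d := by
  classical
  have key : ∀ i, ∃ v : EuclideanSpace ℂ (Fin d), v ≠ 0 ∧
      ∀ j, j ≠ i → F i j v = v ∧ F j i v = 0 := by
    intro i
    obtain ⟨v, hv, h⟩ := exists_ne_zero_apply_eq_zero
      -- The tag `true` stands for `1 - F i j` and `false` for `F j i`; `φ i` vanishes on both, so a
      -- common kernel vector is fixed by every `F i j` and killed by every `F j i`.
      ((Finset.univ.filter (· ≠ i)) ×ˢ (Finset.univ : Finset Bool))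
      (fun p => if p.2 then 1 - F i p.1 else F p.1 i)
      (by
        rintro ⟨j, b⟩
        cases b
        · simpa using hF0 j i
        · simpa using hF1 i j) (φ i) (hφ i) (by simp [h1])
      (by
        rintro ⟨j, b⟩ hj
        have hj' : j ≠ i := by simpa using hj
        cases b
        · simp [(hF j i hj').2]
        · simp [h1, (hF i j hj'.symm).1])
    refine ⟨v, hv, fun j hj => ⟨?_, ?_⟩⟩
    · have := h (j, true) (by simp [hj])
      simp [sub_eq_zero] at this
      exact this.symm
    · simpa using h (j, false) (by simp [hj])
  choose v hv hFv using key
  -- The self-adjoint `F i j` has `v i` and `v j` as eigenvectors for the eigenvalues 1 and 0.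
  have horth : Pairwise fun i j => inner ℂ (v i) (v j) = 0 := by
    intro i j hij
    have hpos := (ContinuousLinearMap.nonneg_iff_isPositive _).mp (hF0 i j)
    have h := hpos.inner_left_eq_inner_right (v i) (v j)
    rw [(hFv i j hij.symm).1, (hFv j i hij).2, inner_zero_right] at h
    exact h
  have := (linearIndependent_of_ne_zero_of_inner_eq_zero hv horth).fintype_card_le_finrank
  simpa using this

theorem TupleTree.exists_run_ne {Γ : TupleTree O S} {r : ℕ} {h h' : List (Fin S)}
    (hne : ¬ Γ.SameFuture r h h') : ∃ v : List (Fin S), v.length = r + 1 ∧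
      Γ.run h v ≠ Γ.run h' v := by
  unfold TupleTree.SameFuture at hne
  push Not at hne
  obtain ⟨w, hw, hΓ⟩ := hne
  obtain ⟨x, hx⟩ := Function.ne_iff.mp hΓ
  -- One input `x` reveals the differing tuple after `w`; the rest is padding to length `r + 1`.
  refine ⟨w ++ x :: List.replicate (r - w.length) x, by simp; omega, fun h => hx ?_⟩
  rw [TupleTree.run_append, TupleTree.run_append] at h
  have := (List.append_inj h (by simp)).2
  simp [TupleTree.run] at this
  exact this.1

theorem le_of_realizable {Γ : TupleTree O S} {j : ℕ} (hS : 0 < S) (hj : 1 ≤ j) (hjL : j ≤ L)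
    (hΓ : Γ.DistinctFuturesAt L j) (h : Realizable d (Γ.correlation L)) : S ^ (j - 1) ≤ d := by
  classical
  obtain ⟨M, hM⟩ := h.exists_machine
  let x0 : Fin S := ⟨0, hS⟩
  let hst : (Fin (j - 1) → Fin S) → List (Fin S) := fun f => List.ofFn f
  have hlen : ∀ f, (hst f).length = j - 1 := fun f => by simp [hst]
  let φ : (Fin (j - 1) → Fin S) → Op d →ₗ[ℂ] ℂ := fun f =>
    (LinearMap.trace ℂ _ ∘ₗ ContinuousLinearMap.coeLM ℂ) ∘ₗ LinearMap.mulLeft ℂ M.ρ ∘ₗ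
      M.step (Γ.run [] (hst f))
  have hφ : ∀ f E, φ f E = tr (M.ρ * M.step (Γ.run [] (hst f)) E) := fun f E => rfl
  have hφeff : ∀ f s, s.length = L - (j - 1) →
      φ f (M.effect s) = if s = Γ.run (hst f) (s.map Prod.fst) then 1 else 0 := by
    intro f s hs
    rw [hφ, ← M.effect_append, hM _ (by simp [hs, hlen]; omega)]
    simp [TupleTree.run_append]
  have hφpos : ∀ f E, 0 ≤ E → 0 ≤ (φ f E).re := fun f E hE =>
    tr_mul_nonneg M.ρ_nonneg (M.step_nonneg _ hE)
  -- Only probabilities of full length `L` are prescribed, so the value at 1 is squeezed: it is at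
  -- most `tr ρ = 1`, and at least the value of an arbitrary completion of the path, which is 1.
  have hφ1 : ∀ f, (φ f 1).re = 1 := by
    intro f
    have hup := tr_mul_nonneg M.ρ_nonneg (sub_nonneg.mpr (M.effect_le_one (Γ.run [] (hst f))))
    have hlow := hφpos f _ (sub_nonneg.mpr (M.effect_le_one
      (Γ.run (hst f) (List.replicate (L - (j - 1)) x0))))
    rw [map_sub, hφeff _ _ (by simp)] at hlow
    rw [mul_sub, mul_one, tr_sub, M.tr_ρ, M.effect_eq_step, ← hφ] at hup
    simp at hlow hup
    linarith
  have hex : ∀ f g : Fin (j - 1) → Fin S, ∃ v : List (Fin S), v.length = L - (j - 1) ∧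
      (f ≠ g → Γ.run (hst f) v ≠ Γ.run (hst g) v) := by
    intro f g
    by_cases hfg : f = g
    · exact ⟨List.replicate (L - (j - 1)) x0, by simp, fun h => absurd hfg h⟩
    · have : ¬ Γ.SameFuture (L - j) (hst f) (hst g) := fun h =>
        hfg (List.ofFn_injective (hΓ _ _ (hlen f) (hlen g) h))
      obtain ⟨v, hv, hne⟩ := TupleTree.exists_run_ne this
      exact ⟨v, by omega, fun _ => hne⟩
  choose v hvlen hv using hex
  have := card_le_of_distinguishable φ hφpos hφ1 (fun f g => M.effect (Γ.run (hst f) (v f g)))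
    (fun _ _ => M.effect_nonneg _) (fun _ _ => M.effect_le_one _) (by
      intro f g hfg
      constructor
      · rw [hφeff _ _ (by simp [hvlen])]
        simp
      · rw [hφeff _ _ (by simp [hvlen])]
        simp [hv f g hfg])
  simpa using this

/-! ### Realization by a finite automaton -/

/-- Positive matrices are sums of `N* N`, and entrywise conjugation by `K` turns `N* N` into `(N K)*
(N K)`. This is the complete positivity of a Kraus map. -/
theorem map_conjugate_nonneg {k : ℕ} {M : CStarMatrix (Fin k) (Fin k) (Op d)} (hM : 0 ≤ M)
    (K : Op d) : 0 ≤ M.map (fun E => star K * E * K) := by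
  rw [StarOrderedRing.nonneg_iff] at hM
  induction hM using AddSubmonoid.closure_induction with
  | zero =>
    refine le_of_eq (CStarMatrix.ext fun a b => ?_)
    simp
  | add a b _ _ ha hb =>
    refine le_of_le_of_eq (add_nonneg ha hb) (CStarMatrix.ext fun a b => ?_)
    simp [mul_add, add_mul]
  | mem N hN =>
    obtain ⟨N, rfl⟩ := hN
    have : (star N * N).map (fun E => star K * E * K) = star (N.map (· * K)) * N.map (· * K) := by
      refine CStarMatrix.ext fun a b => ?_
      simp only [CStarMatrix.map_apply, CStarMatrix.mul_apply, CStarMatrix.star_apply,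
        Finset.mul_sum, Finset.sum_mul, star_mul, mul_assoc]
    rw [this]
    exact star_mul_self_nonneg _

/-- The completely positive map `E ↦ ∑ i, (K i)* E (K i)`. -/
noncomputable def krausMap {ι : Type*} (s : Finset ι) (K : ι → Op d) : Op d →CP Op d where
  toLinearMap := ∑ i ∈ s, LinearMap.mulRight ℂ (K i) ∘ₗ LinearMap.mulLeft ℂ (star (K i))
  map_cstarMatrix_nonneg' k M hM := by
    have e : M.map (∑ i ∈ s, LinearMap.mulRight ℂ (K i) ∘ₗ LinearMap.mulLeft ℂ (star (K i)) :
        Op d →ₗ[ℂ] Op d) = ∑ i ∈ s, M.map (fun E => star (K i) * E * K i) := by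
      classical
      induction s using Finset.induction_on with
      | empty => ext; simp
      | insert i s hi ih =>
        rw [Finset.sum_insert hi, Finset.sum_insert hi, ← ih]
        ext; simp
    rw [e]
    exact Finset.sum_nonneg fun i _ => map_conjugate_nonneg hM (K i)

theorem krausMap_apply {ι : Type*} (s : Finset ι) (K : ι → Op d) (E : Op d) :
    krausMap s K E = ∑ i ∈ s, star (K i) * E * K i := by
  change (∑ i ∈ s, LinearMap.mulRight ℂ (K i) ∘ₗ LinearMap.mulLeft ℂ (star (K i))) E = _
  simp

/-- The rank-one operator `|i⟩⟨k|`. -/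
noncomputable def ketBra (i k : Fin d) : Op d :=
  InnerProductSpace.rankOne ℂ (EuclideanSpace.basisFun (Fin d) ℂ i)
    (EuclideanSpace.basisFun (Fin d) ℂ k)

theorem star_ketBra (i k : Fin d) : star (ketBra i k) = ketBra k i := by
  simp [ketBra, ContinuousLinearMap.star_eq_adjoint]

theorem ketBra_mul_ketBra (i k l m : Fin d) :
    ketBra i k * ketBra l m = if k = l then ketBra i m else 0 := by
  change (InnerProductSpace.rankOne ℂ _ _) ∘L (InnerProductSpace.rankOne ℂ _ _) = _
  rw [InnerProductSpace.rankOne_comp_rankOne,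
    orthonormal_iff_ite.mp (EuclideanSpace.basisFun (Fin d) ℂ).orthonormal k l]
  split_ifs <;> simp [ketBra]

theorem sum_ketBra : ∑ i : Fin d, ketBra i i = 1 :=
  (EuclideanSpace.basisFun (Fin d) ℂ).sum_rankOne_eq_id

theorem tr_ketBra (i : Fin d) : tr (ketBra i i) = 1 := by
  unfold tr ketBra
  rw [InnerProductSpace.trace_rankOne]
  simp

theorem ketBra_nonneg (i : Fin d) : 0 ≤ ketBra i i :=
  (ContinuousLinearMap.nonneg_iff_isPositive _).mpr (InnerProductSpace.isPositive_rankOne_self _)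

open Classical in
/-- The diagonal projection on the basis vectors that satisfy `p`. -/
noncomputable def diagProj (p : Fin d → Prop) : Op d :=
  ∑ i, if p i then ketBra i i else 0

/-- A deterministic automaton with states `Fin d`, as a quantum machine: on input `x` the state
`i` gives the output `out i x` and moves to `next i x`. -/
noncomputable def automatonMachine (i₀ : Fin d) (out : Fin d → Fin S → Fin O)
    (next : Fin d → Fin S → Fin d) : QuantumMachine d O S where
  ρ := ketBra i₀ i₀
  ρ_nonneg := ketBra_nonneg i₀
  tr_ρ := tr_ketBra i₀
  instr x a := krausMap {i | out i x = a} fun i => ketBra (next i x) i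
  unital x := by
    simp only [krausMap_apply, mul_one, star_ketBra, ketBra_mul_ketBra, if_true]
    rw [← sum_ketBra]
    exact Finset.sum_fiberwise _ (fun i => out i x) _

/-- The sequence `s` is produced by the automaton from the state `i`. -/
def Accepts (out : Fin d → Fin S → Fin O) (next : Fin d → Fin S → Fin d) :
    List (Fin S × Fin O) → Fin d → Prop
  | [], _ => True
  | (x, a) :: s, i => out i x = a ∧ Accepts out next s (next i x)

open Classical in
theorem automatonMachine_effect (i₀ : Fin d) (out : Fin d → Fin S → Fin O)
    (next : Fin d → Fin S → Fin d) (s : List (Fin S × Fin O)) :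
    (automatonMachine i₀ out next).effect s = diagProj (Accepts out next s) := by
  induction s with
  | nil =>
    refine sum_ketBra.symm.trans (Finset.sum_congr rfl fun i _ => ?_)
    rw [if_pos (by trivial)]
  | cons xa s ih =>
    obtain ⟨x, a⟩ := xa
    change krausMap {i | out i x = a} (fun i => ketBra (next i x) i)
      ((automatonMachine i₀ out next).effect s) = _
    rw [ih, krausMap_apply]
    simp only [diagProj, Accepts]
    rw [Finset.sum_filter]
    refine Finset.sum_congr rfl fun i _ => ?_
    have h : star (ketBra (next i x) i) * (∑ k, if Accepts out next s k then ketBra k k else 0) *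
        ketBra (next i x) i = if Accepts out next s (next i x) then ketBra i i else 0 := by
      rw [Finset.mul_sum, Finset.sum_eq_single (next i x)]
      · split_ifs <;> simp [star_ketBra, ketBra_mul_ketBra]
      · intro k _ hk
        split_ifs <;> simp [star_ketBra, ketBra_mul_ketBra, hk.symm]
      · simp
    rw [h, ← ite_and]
    congr

open Classical in
theorem tr_automatonMachine (i₀ : Fin d) (out : Fin d → Fin S → Fin O)
    (next : Fin d → Fin S → Fin d) (s : List (Fin S × Fin O)) :
    tr ((automatonMachine i₀ out next).ρ * (automatonMachine i₀ out next).effect s) =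
      if Accepts out next s i₀ then 1 else 0 := by
  rw [automatonMachine_effect]
  change tr (ketBra i₀ i₀ * _) = _
  simp only [diagProj, Finset.mul_sum, mul_ite, ketBra_mul_ketBra, mul_zero]
  rw [Finset.sum_eq_single i₀ (fun i _ hi => by simp [hi.symm]) (by simp)]
  simp only [if_true]
  split_ifs
  · exact tr_ketBra i₀
  · simp [tr]

/-- The states are the input histories of length at most `L`, finitely many, and each step appends
the current input. -/
theorem exists_realizable (Γ : TupleTree O S) (L : ℕ) : ∃ d, Realizable d (Γ.correlation L) := by
  classical
  have hfin : Finite {h : List (Fin S) // h.length ≤ L} := (List.finite_length_le (Fin S) L).to_subtype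
  obtain ⟨d, ⟨e⟩⟩ := Finite.exists_equiv_fin {h : List (Fin S) // h.length ≤ L}
  let out : Fin d → Fin S → Fin O := fun i x => Γ (e.symm i).1 x
  let next : Fin d → Fin S → Fin d := fun i x =>
    -- Staying put at the horizon is a dummy value, never reached by sequences of length at most `L`
    -- started at the root.
    if h : (e.symm i).1.length + 1 ≤ L then e ⟨(e.symm i).1 ++ [x], by simpa using h⟩ else i
  have key : ∀ (s : List (Fin S × Fin O)) (h : {h : List (Fin S) // h.length ≤ L}),
      h.1.length + s.length ≤ L →
      (Accepts out next s (e h) ↔ s = Γ.run h.1 (s.map Prod.fst)) := by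
    intro s
    induction s with
    | nil => simp [Accepts, TupleTree.run]
    | cons xa s ih =>
      obtain ⟨x, a⟩ := xa
      intro h hs
      simp only [List.length_cons] at hs
      have hn : next (e h) x = e ⟨h.1 ++ [x], by simp; omega⟩ := by
        have h1 : h.1.length + 1 ≤ L := by omega
        simp only [next, Equiv.symm_apply_apply]
        exact dif_pos h1
      simp only [Accepts, hn, TupleTree.run, List.map_cons, List.cons.injEq, Prod.mk.injEq,
        true_and]
      rw [ih _ (by simp; omega)]
      simp [out, eq_comm]
  refine ⟨d, automatonMachine (e ⟨[], by simp⟩) out next, fun x a => ?_⟩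
  rw [tr_automatonMachine, TupleTree.correlation_eq, key _ _ (by simp)]
  have : (List.ofFn fun i => (x i, a i)).map Prod.fst = List.ofFn x := by
    simp [List.map_ofFn, Function.comp_def]
  rw [this]
  split_ifs <;> simp

theorem minDim_ne_top (Γ : TupleTree O S) (L : ℕ) : minDim (Γ.correlation L) ≠ ⊤ := by
  obtain ⟨d, hd⟩ := exists_realizable Γ L
  exact ne_top_of_le_ne_top (ENat.natCast_ne_top d) (iInf₂_le d hd)

theorem le_minDim {Γ : TupleTree O S} {j : ℕ} (hS : 0 < S) (hj : 1 ≤ j) (hjL : j ≤ L)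
    (hΓ : Γ.DistinctFuturesAt L j) : ((S ^ (j - 1) : ℕ) : ℕ∞) ≤ minDim (Γ.correlation L) :=
  le_iInf₂ fun _ hd => Nat.cast_le.mpr (le_of_realizable hS hj hjL hΓ hd)

/-! ### Deterministic correlations are extreme points -/

/-- The outputs of a tree along a sequence of inputs. -/
def TupleTree.output (Γ : TupleTree O S) (x : Fin L → Fin S) (i : Fin L) : Fin O :=
  Γ ((List.ofFn x).take i) (x i)

theorem TupleTree.output_congr (Γ : TupleTree O S) {k : ℕ} {x x' : Fin L → Fin S}
    (h : ∀ i : Fin L, (i : ℕ) < k → x i = x' i) {i : Fin L} (hi : (i : ℕ) < k) :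
    Γ.output x i = Γ.output x' i := by
  unfold TupleTree.output
  rw [h i hi]
  congr 1
  apply List.ext_getElem (by simp)
  intro n h1 h2
  simp at h1
  simp only [List.getElem_take, List.getElem_ofFn]
  exact h _ (by simp; omega)

theorem TupleTree.correlation_eq_output (Γ : TupleTree O S) (x : Fin L → Fin S)
    (a : Fin L → Fin O) : Γ.correlation L x a = if a = Γ.output x then 1 else 0 := by
  unfold TupleTree.correlation TupleTree.output
  simp only [funext_iff]

theorem TupleTree.marginal_correlation (Γ : TupleTree O S) (k : ℕ) (x : Fin L → Fin S)
    (b : Fin L → Fin O) : marginal (Γ.correlation L) k x b =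
      if ∀ i : Fin L, (i : ℕ) < k → Γ.output x i = b i then 1 else 0 := by
  unfold marginal
  simp only [TupleTree.correlation_eq_output]
  rw [Finset.sum_ite_eq']
  simp

theorem TupleTree.correlation_mem (Γ : TupleTree O S) (L : ℕ) :
    Γ.correlation L ∈ aotPolytope L O S := by
  refine ⟨fun x a => ?_, fun x => ?_, fun k _ x x' h b => ?_⟩
  · rw [TupleTree.correlation_eq_output]
    split_ifs <;> norm_num
  · simp [TupleTree.correlation_eq_output]
  · rw [TupleTree.marginal_correlation, TupleTree.marginal_correlation]
    congr 1
    refine propext (forall_congr' fun i => imp_congr_right fun hi => ?_)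
    rw [Γ.output_congr h hi]

theorem le_one_of_mem_aotPolytope {p : Correlation L O S} (hp : p ∈ aotPolytope L O S)
    (x : Fin L → Fin S) (a : Fin L → Fin O) : p x a ≤ 1 := by
  rw [← hp.2.1 x]
  exact Finset.single_le_sum (f := p x) (fun b _ => hp.1 x b) (Finset.mem_univ a)

/-- All entries of points of the polytope lie in `[0, 1]`, and those of a tree are 0 or 1, the
extreme points of that interval. -/
theorem TupleTree.correlation_mem_extremePoints (Γ : TupleTree O S) (L : ℕ) :
    Γ.correlation L ∈ Set.extremePoints ℝ (aotPolytope L O S) := by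
  refine mem_extremePoints_iff_left.mpr ⟨Γ.correlation_mem L, ?_⟩
  rintro p hp q hq ⟨s, t, hs, ht, hst, h⟩
  funext x a
  have hxa : s * p x a + t * q x a = Γ.correlation L x a := congrFun (congrFun h x) a
  have hp0 := hp.1 x a
  have hq0 := hq.1 x a
  have hp1 := le_one_of_mem_aotPolytope hp x a
  have hq1 := le_one_of_mem_aotPolytope hq x a
  rw [TupleTree.correlation_eq_output] at hxa ⊢
  split_ifs at hxa ⊢ <;> nlinarith

/-! ### Counting futures and the optimal time-step -/

theorem exists_distinctFuturesAt (hO : 1 ≤ O) {j : ℕ}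
    (h : S ^ (j - 1) ≤ (O ^ S) ^ ∑ k ∈ Finset.range (L - j + 1), S ^ k) :
    ∃ Γ : TupleTree O S, Γ.DistinctFuturesAt L j := by
  classical
  -- A future is encoded as a map from words of length at most `L - j` to output tuples; the
  -- embedding `f` below gives each node its own future.
  have hcard : Fintype.card (List.Vector (Fin S) (j - 1)) ≤
      Fintype.card ((Σ k : Fin (L - j + 1), List.Vector (Fin S) k) → Fin S → Fin O) := by
    simp only [Fintype.card_fun, Fintype.card_fin, Fintype.card_sigma, card_vector]
    rwa [Fin.sum_univ_eq_sum_range (fun k => S ^ k)]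
  obtain ⟨f⟩ := Function.Embedding.nonempty_of_card_le hcard
  let node : List (Fin S) → Σ k : Fin (L - j + 1), List.Vector (Fin S) k := fun w =>
    -- Words beyond the horizon get a dummy value, as do the nodes before time-step `j` in `Γ`.
    if hw : w.length < L - j + 1 then ⟨⟨w.length, hw⟩, ⟨w, rfl⟩⟩ else ⟨0, List.Vector.nil⟩
  let Γ : TupleTree O S := fun l =>
    if hl : (l.take (j - 1)).length = j - 1 then f ⟨l.take (j - 1), hl⟩ (node (l.drop (j - 1)))
    else fun _ => ⟨0, hO⟩
  have hΓ : ∀ (h : List (Fin S)) (hh : h.length = j - 1) (w : List (Fin S)),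
      Γ (h ++ w) = f ⟨h, hh⟩ (node w) := by
    intro h hh w
    have h1 : (h ++ w).take (j - 1) = h := by rw [← hh, List.take_left]
    have h2 : (h ++ w).drop (j - 1) = w := by rw [← hh, List.drop_left]
    simp only [Γ, h1, h2, dif_pos hh]
  refine ⟨Γ, fun h h' hh hh' hsame => ?_⟩
  have : f ⟨h, hh⟩ = f ⟨h', hh'⟩ := by
    funext ⟨⟨k, hk⟩, ⟨w, hw⟩⟩
    obtain rfl : w.length = k := hw
    have hn : node w = ⟨⟨w.length, hk⟩, ⟨w, rfl⟩⟩ := dif_pos hk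
    rw [← hn, ← hΓ h hh, ← hΓ h' hh']
    exact hsame w (by omega)
  exact congrArg Subtype.val (f.injective this)

/-- The integers `i` for which there are at least as many futures of time-step `i` as nodes. -/
def admissible (O S L : ℕ) : Set ℤ :=
  {i : ℤ | (S : ℝ) ^ (i - 1) ≤
    (O : ℝ) ^ (((S : ℝ) ^ ((L : ℤ) - i + 2) - (S : ℝ)) / ((S : ℝ) - 1))}

/-- The number `O ^ (S / (S - 1))`. -/
noncomputable def outBase (O S : ℕ) : ℝ := (O : ℝ) ^ ((S : ℝ) / ((S : ℝ) - 1))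

theorem log_outBase (hO : 1 ≤ O) : Real.log (outBase O S) = S / (S - 1) * Real.log O :=
  Real.log_rpow (by exact_mod_cast hO) _

theorem one_le_outBase (hO : 1 ≤ O) (hS : 2 ≤ S) : 1 ≤ outBase O S := by
  have : (2 : ℝ) ≤ S := by exact_mod_cast hS
  exact Real.one_le_rpow (by exact_mod_cast hO) (div_nonneg (by linarith) (by linarith))

theorem two_le_outBase (hO : 2 ≤ O) (hS : 2 ≤ S) : 2 ≤ outBase O S := by
  have hS' : (2 : ℝ) ≤ S := by exact_mod_cast hS
  have hO' : (2 : ℝ) ≤ O := by exact_mod_cast hO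
  calc (2 : ℝ) ≤ (O : ℝ) ^ (1 : ℝ) := by rwa [Real.rpow_one]
    _ ≤ outBase O S := Real.rpow_le_rpow_of_exponent_le (by linarith)
        (by rw [le_div_iff₀] <;> linarith)

theorem zArg_eq (hO : 1 ≤ O) (hS : 2 ≤ S) :
    S * zArg O S L = S ^ L * (outBase O S * Real.log (outBase O S)) := by
  have hS' : (2 : ℝ) ≤ S := by exact_mod_cast hS
  have h1 : (S : ℝ) - 1 ≠ 0 := by linarith
  rw [log_outBase hO, zArg, outBase]
  field_simp

/-- In logarithms the condition reads `y ≤ S ^ (L - i + 2) ln O / (S - 1)` with `y = (i - 1) ln S +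
ln u`. Multiplication by `e^y = S ^ (i - 1) u` removes `i` from the right-hand side. -/
theorem mem_admissible_iff (hO : 1 ≤ O) (hS : 2 ≤ S) (i : ℤ) :
    i ∈ admissible O S L ↔
      ((i - 1) * Real.log S + Real.log (outBase O S)) *
        Real.exp ((i - 1) * Real.log S + Real.log (outBase O S)) ≤ S * zArg O S L := by
  have hS' : (2 : ℝ) ≤ S := by exact_mod_cast hS
  have hS0 : (0 : ℝ) < S := by linarith
  have hO0 : (0 : ℝ) < O := by exact_mod_cast hO
  have h1 : 0 < (S : ℝ) - 1 := by linarith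
  have hu : 0 < outBase O S := by linarith [one_le_outBase hO hS]
  have hexp : Real.exp ((i - 1) * Real.log S + Real.log (outBase O S)) =
      (S : ℝ) ^ (i - 1) * outBase O S := by
    rw [Real.exp_add, Real.exp_log hu, mul_comm _ (Real.log _), ← Real.rpow_def_of_pos hS0]
    congr 1
    rw [← Real.rpow_intCast]
    push_cast
    rfl
  have hX : S * zArg O S L =
      ((S : ℝ) ^ ((L : ℤ) - i + 2) / (S - 1) * Real.log O) * ((S : ℝ) ^ (i - 1) * outBase O S) := by
    have : (S : ℝ) ^ ((L : ℤ) - i + 2) * (S : ℝ) ^ (i - 1) = S ^ L * S := by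
      rw [← zpow_add₀ hS0.ne', ← pow_succ, ← zpow_natCast]
      congr 1
      push_cast
      ring
    calc S * zArg O S L = (S ^ L * S) * outBase O S * Real.log O / (S - 1) := by
          rw [zArg, outBase]; ring
      _ = _ := by rw [← this]; ring
  rw [hexp, hX, mul_le_mul_iff_left₀ (by positivity), log_outBase hO]
  change (S : ℝ) ^ (i - 1) ≤ _ ↔ _
  rw [← Real.log_le_log_iff (by positivity) (by positivity), Real.log_zpow, Real.log_rpow hO0,
    sub_div]
  push_cast
  constructor <;> intro h <;> nlinarith

theorem exists_isGreatest_admissible (hO : 1 ≤ O) (hS : 2 ≤ S) (hL : 1 ≤ L) :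
    ∃ j : ℕ, 1 ≤ j ∧ j ≤ L ∧ IsGreatest (admissible O S L) (j : ℤ) := by
  have hS' : (2 : ℝ) ≤ S := by exact_mod_cast hS
  have hO1 : (1 : ℝ) ≤ O := by exact_mod_cast hO
  have hmem : (1 : ℤ) ∈ admissible O S L := by
    change (S : ℝ) ^ ((1 : ℤ) - 1) ≤ _
    simp only [sub_self, zpow_zero]
    refine Real.one_le_rpow hO1 (div_nonneg ?_ (by linarith))
    have : (S : ℝ) ^ (1 : ℤ) ≤ (S : ℝ) ^ ((L : ℤ) - 1 + 2) :=
      zpow_le_zpow_right₀ (by linarith) (by omega)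
    rw [zpow_one] at this
    linarith
  -- For `i > L` the exponent of `O` is at most 0, whereas `S ^ (i - 1) ≥ S > 1`.
  have hbdd : ∀ i ∈ admissible O S L, i ≤ (L : ℤ) := by
    intro i hi
    by_contra! hlt
    have hi : (S : ℝ) ^ (i - 1) ≤ _ := hi
    have h1 : (S : ℝ) ^ ((L : ℤ) - i + 2) ≤ (S : ℝ) ^ (1 : ℤ) :=
      zpow_le_zpow_right₀ (by linarith) (by omega)
    have h2 : (S : ℝ) ^ (1 : ℤ) ≤ (S : ℝ) ^ (i - 1) :=
      zpow_le_zpow_right₀ (by linarith) (by omega)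
    rw [zpow_one] at h1 h2
    have h3 : (O : ℝ) ^ (((S : ℝ) ^ ((L : ℤ) - i + 2) - (S : ℝ)) / ((S : ℝ) - 1)) ≤ 1 :=
      Real.rpow_le_one_of_one_le_of_nonpos hO1
        (div_nonpos_of_nonpos_of_nonneg (by linarith) (by linarith))
    linarith
  obtain ⟨j, hj, hmax⟩ := Int.exists_greatest_of_bdd (P := (· ∈ admissible O S L)) ⟨L, hbdd⟩
    ⟨1, hmem⟩
  have hj1 := hmax 1 hmem
  have hjL := hbdd j hj
  lift j to ℕ using by omega
  exact ⟨j, by omega, by omega, hj, fun i hi => hmax i hi⟩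

/-! ### The Lambert function -/

theorem lambertW_spec {x : ℝ} (hx : 0 ≤ x) :
    0 ≤ lambertW x ∧ lambertW x * Real.exp (lambertW x) = x := by
  have hex : ∃ w ∈ Set.Ici (-1 : ℝ), (fun w : ℝ => w * Real.exp w) w = x := by
    have hc : ContinuousOn (fun w : ℝ => w * Real.exp w) (Set.Icc 0 x) := by fun_prop
    obtain ⟨w, hw, h⟩ := intermediate_value_Icc hx hc (show x ∈ Set.Icc _ _ by
      have := Real.one_le_exp hx
      constructor
      · simpa using hx
      · nlinarith)
    exact ⟨w, by have := hw.1; simp; linarith, h⟩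
  have h : lambertW x * Real.exp (lambertW x) = x := Function.invFunOn_eq hex
  refine ⟨?_, h⟩
  by_contra! hneg
  have := mul_neg_of_neg_of_pos hneg (Real.exp_pos (lambertW x))
  linarith

/-- No lower bound on `y` is needed, although `w e^w` is monotone only from `-1` on: since `x ≥ 0`,
both sides hold for negative `y`. -/
theorem mul_exp_le_iff {x y : ℝ} (hx : 0 ≤ x) :
    y * Real.exp y ≤ x ↔ y ≤ lambertW x := by
  obtain ⟨h0, h⟩ := lambertW_spec hx
  constructor
  · intro hle
    by_contra! hlt
    have := mul_lt_mul'' hlt (Real.exp_lt_exp.mpr hlt) h0 (Real.exp_pos _).le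
    linarith
  · intro hle
    rw [← h]
    exact mul_le_mul hle (Real.exp_le_exp.mpr hle) (Real.exp_pos _).le h0

theorem eq_floor_of_isGreatest (hO : 1 ≤ O) (hS : 2 ≤ S) {j : ℕ} (hj : 1 ≤ j)
    (h : IsGreatest (admissible O S L) (j : ℤ)) :
    (j : ℤ) = ⌊lambertW ((S : ℝ) ^ (L + 1) / ((S : ℝ) - 1) * Real.logb S O *
      (S : ℝ) ^ ((S : ℝ) / ((S : ℝ) - 1) * Real.logb S O) * Real.log S) / Real.log S
        - (S : ℝ) / ((S : ℝ) - 1) * Real.logb S O + 1⌋ := by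
  have hS' : (2 : ℝ) ≤ S := by exact_mod_cast hS
  have hO0 : (0 : ℝ) < O := by exact_mod_cast hO
  have hj' : (1 : ℝ) ≤ j := by exact_mod_cast hj
  have hlog : 0 < Real.log S := Real.log_pos (by linarith)
  have hlogu : 0 ≤ Real.log (outBase O S) := Real.log_nonneg (one_le_outBase hO hS)
  have hX : (S : ℝ) ^ (L + 1) / ((S : ℝ) - 1) * Real.logb S O *
      (S : ℝ) ^ ((S : ℝ) / ((S : ℝ) - 1) * Real.logb S O) * Real.log S = S * zArg O S L := by
    have h1 : (S : ℝ) ^ ((S : ℝ) / ((S : ℝ) - 1) * Real.logb S O) =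
        (O : ℝ) ^ ((S : ℝ) / ((S : ℝ) - 1)) := by
      rw [mul_comm, Real.rpow_mul (by linarith), Real.rpow_logb (by linarith) (by linarith) hO0]
    rw [h1, zArg, Real.logb]
    field_simp
    ring
  have hX0 : 0 ≤ S * zArg O S L := by
    rw [zArg_eq hO hS]
    have := one_le_outBase hO hS
    positivity
  have hc : (S : ℝ) / ((S : ℝ) - 1) * Real.logb S O = Real.log (outBase O S) / Real.log S := by
    rw [log_outBase hO, Real.logb]; ring
  rw [hX, hc, eq_comm, Int.floor_eq_iff]
  have h1 := (mem_admissible_iff hO hS _).mp h.1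
  have h2 : ¬ ((j + 1 : ℤ) ∈ admissible O S L) := fun hm => by have := h.2 hm; omega
  rw [mem_admissible_iff hO hS] at h2
  push_cast at h1 h2 ⊢
  rw [mul_exp_le_iff hX0] at h1 h2
  rw [not_le] at h2
  constructor
  · rw [← sub_le_iff_le_add, ← sub_div, le_div_iff₀ hlog]
    linarith
  · rw [← lt_sub_iff_add_lt, ← sub_div, div_lt_iff₀ hlog]
    linarith

/-! ### Elementary lower bounds without the Lambert function -/

/-- Numerically, `u ≥ 2` and `S ^ L ≥ 2` give `S z_L ≥ 4 ln 2 > e`. -/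
theorem exp_one_le_zArg (hO : 2 ≤ O) (hS : 2 ≤ S) (hL : 1 ≤ L) :
    Real.exp 1 ≤ S * zArg O S L ∧ 1 ≤ outBase O S * Real.log (outBase O S) := by
  have hS' : (2 : ℝ) ≤ S := by exact_mod_cast hS
  have hu := two_le_outBase hO hS
  have h2 := Real.log_two_gt_d9
  have hlu : Real.log 2 ≤ Real.log (outBase O S) := Real.log_le_log (by norm_num) hu
  have h3 : 2 * Real.log 2 ≤ outBase O S * Real.log (outBase O S) := by nlinarith
  have hSL : (2 : ℝ) ≤ (S : ℝ) ^ L := hS'.trans (le_self_pow₀ (by linarith) (by omega))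
  refine ⟨?_, by linarith⟩
  rw [zArg_eq (by omega) hS]
  have := Real.exp_one_lt_d9
  nlinarith

/-- Write `X = S z_L` and `Y = j ln S + ln u`. Since `j + 1` is not admissible, `Y e^Y > X`, which
forces `S ^ j u = e^Y ≥ X / ln X`. -/
theorem le_pow_of_isGreatest (hO : 2 ≤ O) (hS : 2 ≤ S) (hL : 1 ≤ L) {j : ℕ} (hj : 1 ≤ j)
    (h : IsGreatest (admissible O S L) (j : ℤ)) :
    (S : ℝ) ^ (L - 1) * Real.log (outBase O S) / Real.log (S * zArg O S L) ≤ (S : ℝ) ^ (j - 1) := by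
  have hS' : (2 : ℝ) ≤ S := by exact_mod_cast hS
  have hu := two_le_outBase hO hS
  have hX := (exp_one_le_zArg hO hS hL).1
  have hX0 : 0 < S * zArg O S L := (Real.exp_pos 1).trans_le hX
  have hlX : 1 ≤ Real.log (S * zArg O S L) := (Real.le_log_iff_exp_le hX0).mpr hX
  have h2 : ¬ ((j + 1 : ℤ) ∈ admissible O S L) := fun hm => by have := h.2 hm; omega
  rw [mem_admissible_iff (by omega) hS, not_le] at h2
  push_cast at h2
  rw [add_sub_cancel_right] at h2
  have hY0 : 0 ≤ (j : ℝ) * Real.log S + Real.log (outBase O S) :=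
    add_nonneg (mul_nonneg (by positivity) (Real.log_nonneg (by linarith)))
      (Real.log_nonneg (by linarith))
  have hexp : Real.exp ((j : ℝ) * Real.log S + Real.log (outBase O S)) =
      (S : ℝ) ^ j * outBase O S := by
    rw [Real.exp_add, Real.exp_log (by linarith), ← Real.log_pow, Real.exp_log (by positivity)]
  have key : S * zArg O S L / Real.log (S * zArg O S L) ≤ (S : ℝ) ^ j * outBase O S := by
    rw [← hexp]
    -- If `e^Y < X / ln X`, then `e^Y < X` because `ln X ≥ 1`; hence `Y < ln X`, and the product of
    -- the two estimates contradicts `Y e^Y > X`.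
    by_contra! hlt
    have hlt' := hlt.trans_le (div_le_self hX0.le hlX)
    rw [← Real.lt_log_iff_exp_lt hX0] at hlt'
    have := mul_lt_mul'' hlt' hlt hY0 (Real.exp_pos _).le
    rw [mul_div_cancel₀ _ (by linarith)] at this
    linarith
  rw [div_le_iff₀ (by linarith)] at key ⊢
  nth_rw 1 [zArg_eq (by omega) hS] at key
  obtain ⟨L, rfl⟩ : ∃ l, L = l + 1 := ⟨L - 1, by omega⟩
  obtain ⟨j, rfl⟩ : ∃ l, j = l + 1 := ⟨j - 1, by omega⟩
  simp only [add_tsub_cancel_right]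
  rw [pow_succ, pow_succ] at key
  have hpos : 0 < S * outBase O S := by positivity
  refine le_of_mul_le_mul_right ?_ hpos
  linarith

theorem dimBound_eq (hO : 1 ≤ O) (hS : 2 ≤ S) (hL : 1 ≤ L) :
    dimBound O S L = (outBase O S ^ 2)⁻¹ * (S : ℝ) ^ (L - 1) * Real.log (outBase O S) *
      Real.log (zArg O S L) ^ (-1 + (2 * Real.log (zArg O S L))⁻¹) := by
  have hS' : (2 : ℝ) ≤ S := by exact_mod_cast hS
  have h1 : (S : ℝ) - 1 ≠ 0 := by linarith
  have hO0 : (0 : ℝ) < O := by exact_mod_cast hO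
  have h2 : (O : ℝ) ^ (-(2 * (S : ℝ) / ((S : ℝ) - 1))) = (outBase O S ^ 2)⁻¹ := by
    rw [Real.rpow_neg hO0.le, outBase, ← Real.rpow_natCast, ← Real.rpow_mul hO0.le]
    congr 2
    push_cast
    ring
  obtain ⟨L, rfl⟩ : ∃ l, L = l + 1 := ⟨L - 1, by omega⟩
  rw [dimBound, h2, log_outBase hO, add_tsub_cancel_right, pow_succ]
  ring

/-- With `l = ln z_L`, the factor `u⁻² ≤ 1/4` in `D_L` absorbs two losses of a factor 2: `l ^ (1 /
(2 l)) ≤ 2` and `ln (S z_L) ≤ 2 l`. -/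
theorem dimBound_le_pow (hO : 1 ≤ O) (hS : 2 ≤ S) (hL : 1 ≤ L) {j : ℕ} (hj : 1 ≤ j)
    (h : IsGreatest (admissible O S L) (j : ℤ)) (hz : Real.exp 1 ≤ zArg O S L) :
    dimBound O S L ≤ (S : ℝ) ^ (j - 1) := by
  have hS' : (2 : ℝ) ≤ S := by exact_mod_cast hS
  have hO2 : 2 ≤ O := by
    by_contra hlt
    obtain rfl : O = 1 := by omega
    simp [zArg] at hz
    linarith [Real.exp_pos 1]
  have hu := two_le_outBase hO2 hS
  have hz0 : 0 < zArg O S L := (Real.exp_pos 1).trans_le hz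
  have hl : 1 ≤ Real.log (zArg O S L) := (Real.le_log_iff_exp_le hz0).mpr hz
  have hX := (exp_one_le_zArg hO2 hS hL).1
  have hX0 : 0 < S * zArg O S L := (Real.exp_pos 1).trans_le hX
  have hlX : 1 ≤ Real.log (S * zArg O S L) := (Real.le_log_iff_exp_le hX0).mpr hX
  have hlu : 0 < Real.log (outBase O S) := Real.log_pos (by linarith)
  rw [dimBound_eq hO hS hL]
  set u := outBase O S
  set l := Real.log (zArg O S L)
  -- The estimate `S ≤ z_L` behind `ln (S z_L) ≤ 2 l` is derived from `L ≥ 2`; for `L = 1` the bound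
  -- is at most 1 anyway.
  rcases hL.eq_or_lt with rfl | hL2
  · have h1 : l ^ (-1 + (2 * l)⁻¹) ≤ 1 := by
      apply Real.rpow_le_one_of_one_le_of_nonpos hl
      have : (2 * l)⁻¹ ≤ 1 := inv_le_one_of_one_le₀ (by linarith)
      linarith
    have h2 : (u ^ 2)⁻¹ * Real.log u ≤ 1 := by
      rw [inv_mul_le_iff₀ (by positivity)]
      have := Real.log_le_sub_one_of_pos (show 0 < u by linarith)
      nlinarith
    calc (u ^ 2)⁻¹ * (S : ℝ) ^ (1 - 1) * Real.log u * l ^ (-1 + (2 * l)⁻¹)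
        = ((u ^ 2)⁻¹ * Real.log u) * l ^ (-1 + (2 * l)⁻¹) := by simp
      _ ≤ 1 := mul_le_one₀ h2 (Real.rpow_nonneg (by linarith) _) h1
      _ ≤ (S : ℝ) ^ (j - 1) := one_le_pow₀ (by linarith)
  · refine le_trans ?_ (le_pow_of_isGreatest hO2 hS hL hj h)
    have hSz : (S : ℝ) ≤ zArg O S L := by
      have h1 := zArg_eq (L := L) hO hS
      have h2 := (exp_one_le_zArg hO2 hS hL).2
      have h3 : (S : ℝ) ^ 2 ≤ S ^ L := pow_le_pow_right₀ (by linarith) hL2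
      have h4 : (S : ℝ) ^ 2 ≤ S * zArg O S L := by rw [h1]; nlinarith
      nlinarith
    have hlogX : Real.log (S * zArg O S L) ≤ 2 * l := by
      rw [Real.log_mul (by linarith) hz0.ne']
      have := Real.log_le_log (by linarith) hSz
      linarith
    have hp : l ^ ((2 * l)⁻¹) ≤ 2 := by
      rw [Real.rpow_def_of_pos (by linarith)]
      have h1 : Real.log l * (2 * l)⁻¹ ≤ 1 / 2 := by
        have := Real.log_le_sub_one_of_pos (show 0 < l by linarith)
        rw [← div_eq_mul_inv, div_le_iff₀ (by linarith)]
        linarith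
      have h2 : (1 : ℝ) / 2 ≤ Real.log 2 := by linarith [Real.log_two_gt_d9]
      exact (Real.le_log_iff_exp_le (by norm_num)).mp (h1.trans h2)
    rw [Real.rpow_add (by linarith), Real.rpow_neg_one, div_eq_mul_inv]
    have h5 : (u ^ 2)⁻¹ * (l⁻¹ * l ^ ((2 * l)⁻¹)) ≤ (Real.log (S * zArg O S L))⁻¹ := by
      calc (u ^ 2)⁻¹ * (l⁻¹ * l ^ ((2 * l)⁻¹)) ≤ (2 ^ 2)⁻¹ * (l⁻¹ * 2) := by gcongr
        _ = (2 * l)⁻¹ := by rw [mul_inv]; ring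
        _ ≤ _ := inv_anti₀ (by linarith) hlogX
    calc (u ^ 2)⁻¹ * (S : ℝ) ^ (L - 1) * Real.log u * (l⁻¹ * l ^ ((2 * l)⁻¹))
        = (S : ℝ) ^ (L - 1) * Real.log u * ((u ^ 2)⁻¹ * (l⁻¹ * l ^ ((2 * l)⁻¹))) := by ring
      _ ≤ _ := by gcongr

theorem pow_le_of_mem_admissible (hS : 2 ≤ S) {j : ℕ} (hj : 1 ≤ j) (hjL : j ≤ L)
    (h : (j : ℤ) ∈ admissible O S L) :
    S ^ (j - 1) ≤ (O ^ S) ^ ∑ k ∈ Finset.range (L - j + 1), S ^ k := by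
  have hS' : (2 : ℝ) ≤ S := by exact_mod_cast hS
  have h : (S : ℝ) ^ ((j : ℤ) - 1) ≤ _ := h
  have e1 : ((j : ℤ) - 1) = ((j - 1 : ℕ) : ℤ) := by omega
  have e2 : ((L : ℤ) - j + 2) = ((L - j + 1 + 1 : ℕ) : ℤ) := by omega
  have e3 : ((S : ℝ) ^ (L - j + 1 + 1) - S) / (S - 1) =
      ((S * ∑ k ∈ Finset.range (L - j + 1), S ^ k : ℕ) : ℝ) := by
    push_cast
    rw [geom_sum_eq (by linarith), pow_succ]
    ring
  rw [e1, e2, zpow_natCast, zpow_natCast, e3, Real.rpow_natCast, pow_mul] at h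
  exact_mod_cast h

/-! ### Asymptotics for long sequences -/

section

open Filter

theorem isBigO_log_affine {b c : ℝ} (hb : 0 < b) :
    (fun L : ℕ => Real.log (b * L + c) - Real.log (b * L)) =O[atTop] fun L : ℕ => 1 / (L : ℝ) := by
  have ht : Tendsto (fun L : ℕ => c / b * (1 / (L : ℝ))) atTop (nhds 0) := by
    simpa using (tendsto_one_div_atTop_nhds_zero_nat (𝕜 := ℝ)).const_mul (c / b)
  have hd : HasDerivAt (fun t : ℝ => Real.log (1 + t)) 1 0 := by
    simpa using ((hasDerivAt_id (0 : ℝ)).const_add 1).log (by simp)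
  have h := (hd.isBigO_sub.comp_tendsto ht).trans
    (((Asymptotics.isBigO_refl (fun L : ℕ => 1 / (L : ℝ)) atTop).const_mul_left (c / b)).congr_left
      fun L => (sub_zero _).symm)
  refine h.congr' ?_ EventuallyEq.rfl
  have hpos : ∀ᶠ L : ℕ in atTop, -1 < c / b * (1 / (L : ℝ)) :=
    ht.eventually (lt_mem_nhds (by norm_num))
  filter_upwards [hpos, eventually_gt_atTop 0] with L hL hL0
  have hL0' : (0 : ℝ) < L := by exact_mod_cast hL0
  have e : b * (L : ℝ) + c = b * L * (1 + c / b * (1 / (L : ℝ))) := by field_simp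
  simp only [Function.comp_apply, add_zero, Real.log_one, sub_zero]
  rw [e, Real.log_mul (by positivity) (by linarith)]
  ring

theorem isBigO_inv_affine {b c : ℝ} (hb : 0 < b) :
    (fun L : ℕ => (b * (L : ℝ) + c)⁻¹) =O[atTop] fun L : ℕ => 1 / (L : ℝ) := by
  refine Asymptotics.IsBigO.of_bound (2 / b) ?_
  filter_upwards [(tendsto_natCast_atTop_atTop (R := ℝ)).eventually_ge_atTop (2 * |c| / b),
    eventually_gt_atTop 0] with L hL hL0
  have hL0' : (0 : ℝ) < L := by exact_mod_cast hL0
  rw [div_le_iff₀ hb] at hL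
  have h1 : b * L / 2 ≤ b * (L : ℝ) + c := by linarith [neg_abs_le c]
  have h2 : 0 < b * (L : ℝ) / 2 := by positivity
  rw [Real.norm_of_nonneg (by rw [inv_nonneg]; linarith), Real.norm_of_nonneg (by positivity)]
  calc (b * (L : ℝ) + c)⁻¹ ≤ (b * L / 2)⁻¹ := inv_anti₀ h2 h1
    _ = 2 / b * (1 / L) := by field_simp

theorem isBigO_log_mul_rpow {b c : ℝ} (hb : 0 < b) :
    (fun L : ℕ => b * L * (b * L + c) ^ (-1 + (2 * (b * L + c))⁻¹) /
      Real.exp ((2 * b)⁻¹ / L * Real.log L) - 1) =O[atTop] fun L : ℕ => 1 / (L : ℝ) := by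
  set r : ℕ → ℝ := fun L => Real.log (b * L + c) - Real.log (b * L) with hr
  have hrO : r =O[atTop] fun L : ℕ => 1 / (L : ℝ) := isBigO_log_affine hb
  have hinv : (fun L : ℕ => (b * (L : ℝ) + c)⁻¹) =O[atTop] fun L : ℕ => 1 / (L : ℝ) :=
    isBigO_inv_affine hb
  have hto0 : Tendsto (fun L : ℕ => 1 / (L : ℝ)) atTop (nhds 0) :=
    tendsto_one_div_atTop_nhds_zero_nat
  have hone : (fun L : ℕ => 1 / (L : ℝ)) =O[atTop] fun _ : ℕ => (1 : ℝ) := hto0.isBigO_one ℝ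
  have hlogL : (fun L : ℕ => Real.log (L : ℝ) * (1 / (L : ℝ))) =O[atTop] fun _ : ℕ => (1 : ℝ) := by
    have h := (Real.isLittleO_log_id_atTop.comp_tendsto
      (tendsto_natCast_atTop_atTop (R := ℝ))).isBigO.mul
        (Asymptotics.isBigO_refl (fun L : ℕ => 1 / (L : ℝ)) atTop)
    refine h.trans (Asymptotics.IsBigO.of_bound 1 ?_)
    filter_upwards [eventually_gt_atTop 0] with L hL0
    have hL0' : (L : ℝ) ≠ 0 := by exact_mod_cast hL0.ne'
    simp [hL0']
  -- `g` is the logarithm of the quotient. The terms in `ln L` combine through `1 / (b L + c) - 1 /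
  -- (b L) = -c / (b L (b L + c))`, which leaves only terms of order `1 / L`.
  set g : ℕ → ℝ := fun L => -r L + ((Real.log b + r L) / 2 * (b * (L : ℝ) + c)⁻¹ +
    -(c / (2 * b)) * (Real.log (L : ℝ) * (1 / (L : ℝ)) * (b * (L : ℝ) + c)⁻¹)) with hg
  have hgO : g =O[atTop] fun L : ℕ => 1 / (L : ℝ) := by
    refine hrO.neg_left.add (Asymptotics.IsBigO.add ?_ (Asymptotics.IsBigO.const_mul_left ?_ _))
    · have h1 : (fun L => (Real.log b + r L) / 2) =O[atTop] fun _ : ℕ => (1 : ℝ) := by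
        have := ((Asymptotics.isBigO_const_const (Real.log b) (one_ne_zero (α := ℝ)) atTop).add
          (hrO.trans hone)).const_mul_left (2⁻¹ : ℝ)
        exact this.congr_left fun L => by ring
      simpa using h1.mul hinv
    · simpa using hlogL.mul hinv
  have hexp : (fun L => Real.exp (g L) - 1) =O[atTop] fun L : ℕ => 1 / (L : ℝ) := by
    have h := (Real.hasDerivAt_exp 0).isBigO_sub.comp_tendsto (hgO.trans_tendsto hto0)
    simp only [Function.comp_def, Real.exp_zero, sub_zero] at h
    exact h.trans hgO
  refine hexp.congr' ?_ EventuallyEq.rfl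
  filter_upwards [(tendsto_natCast_atTop_atTop (R := ℝ)).eventually_gt_atTop (|c| / b),
    eventually_gt_atTop 0] with L hL hL0
  have hL0' : (0 : ℝ) < L := by exact_mod_cast hL0
  rw [div_lt_iff₀ hb] at hL
  have hpos : 0 < b * (L : ℝ) + c := by linarith [neg_abs_le c]
  have hbL : 0 < b * (L : ℝ) := by positivity
  rw [Real.rpow_def_of_pos hpos, ← Real.exp_log hbL, ← Real.exp_add, ← Real.exp_sub,
    Real.exp_log hbL]
  congr 2
  simp only [hg, hr]
  rw [Real.log_mul hb.ne' hL0'.ne']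
  field_simp
  ring

end

/-! ### Bounds on the minimal dimension -/

theorem exists_lower_bound (hO : 1 ≤ O) (hS : 2 ≤ S) {L : ℕ} {j : ℕ} (hj : 1 ≤ j)
    (hjL : j ≤ L) (h : IsGreatest (admissible O S L) (j : ℤ)) :
    ∃ Γ : TupleTree O S,
      Γ.correlation L ∈ Set.extremePoints ℝ (aotPolytope L O S) ∧
      Γ.DistinctFuturesAt L j ∧ minDim (Γ.correlation L) ≠ ⊤ ∧
      ((S ^ (j - 1) : ℕ) : ℕ∞) ≤ minDim (Γ.correlation L) := by
  obtain ⟨Γ, hΓ⟩ := exists_distinctFuturesAt hO (pow_le_of_mem_admissible hS hj hjL h.1)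
  exact ⟨Γ, Γ.correlation_mem_extremePoints L, hΓ, minDim_ne_top Γ L,
    le_minDim (by omega) hj hjL hΓ⟩

theorem pow_le_dMin (hO : 1 ≤ O) (hS : 2 ≤ S) {L : ℕ} {j : ℕ} (hj : 1 ≤ j)
    (hjL : j ≤ L) (h : IsGreatest (admissible O S L) (j : ℤ)) :
    ((S ^ (j - 1) : ℕ) : ℕ∞) ≤ dMin L O S := by
  obtain ⟨Γ, hext, -, -, hle⟩ := exists_lower_bound hO hS hj hjL h
  exact hle.trans (le_iSup₂ (f := fun p (_ : p ∈ Set.extremePoints ℝ (aotPolytope L O S)) =>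
    minDim p) _ hext)

theorem ofReal_le_dMin (hO : 1 ≤ O) (hS : 2 ≤ S) {L : ℕ} {j : ℕ} (hj : 1 ≤ j)
    (hjL : j ≤ L) (h : IsGreatest (admissible O S L) (j : ℤ)) {r : ℝ}
    (hr : r ≤ (S : ℝ) ^ (j - 1)) : ENNReal.ofReal r ≤ (dMin L O S : ℝ≥0∞) := by
  calc ENNReal.ofReal r ≤ ENNReal.ofReal ((S ^ (j - 1) : ℕ) : ℝ) :=
        ENNReal.ofReal_le_ofReal (by push_cast; exact hr)
    _ = (((S ^ (j - 1) : ℕ) : ℕ∞) : ℝ≥0∞) := by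
        rw [ENNReal.ofReal_natCast, ENat.toENNReal_coe]
    _ ≤ dMin L O S := ENat.toENNReal_le.mpr (pow_le_dMin hO hS hj hjL h)

theorem exists_dimBound_asymptotics (hO : 2 ≤ O) (hS : 2 ≤ S) :
    ∃ A B α β γ δ : ℝ, 0 < A ∧ 0 < B ∧ 0 < α ∧ β = Real.log S ∧ γ = 1 ∧
      (∀ L : ℕ, 1 ≤ L → dimBound O S L =
        A * (S : ℝ) ^ (L - 1) * Real.log (B * (S : ℝ) ^ L) ^
          (-1 + (2 * Real.log (B * (S : ℝ) ^ L))⁻¹)) ∧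
      (fun L : ℕ => dimBound O S L /
          (α * Real.exp (β * L + (δ / L - γ) * Real.log L)) - 1)
        =O[Filter.atTop] (fun L : ℕ => 1 / (L : ℝ)) := by
  have hS' : (2 : ℝ) ≤ S := by exact_mod_cast hS
  have hO' : (2 : ℝ) ≤ O := by exact_mod_cast hO
  have hu := two_le_outBase hO hS
  have hlu : 0 < Real.log (outBase O S) := Real.log_pos (by linarith)
  have hβ : 0 < Real.log S := Real.log_pos (by linarith)
  set A := (outBase O S ^ 2)⁻¹ * Real.log (outBase O S) with hA
  set B := outBase O S * Real.log (outBase O S) / S with hB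
  have hA0 : 0 < A := by positivity
  have hB0 : 0 < B := by positivity
  have hz : ∀ L, zArg O S L = B * S ^ L := by
    intro L
    have := zArg_eq (L := L) (show 1 ≤ O by omega) hS
    rw [hB]
    field_simp
    linarith
  have hD : ∀ L : ℕ, 1 ≤ L → dimBound O S L =
      A * (S : ℝ) ^ (L - 1) * Real.log (B * (S : ℝ) ^ L) ^
        (-1 + (2 * Real.log (B * (S : ℝ) ^ L))⁻¹) := by
    intro L hL
    rw [dimBound_eq (by omega) hS hL, hz]
    ring
  -- Here `ln z_L = L ln S + ln B`, so `D_L` behaves like `A S ^ (L - 1) / (L ln S)` times `L ^ (1 /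
  -- (2 L ln S))`; this gives `α` and `δ`.
  refine ⟨A, B, A / (S * Real.log S), Real.log S, 1, (2 * Real.log S)⁻¹, hA0, hB0,
    by positivity, rfl, rfl, hD, ?_⟩
  refine (isBigO_log_mul_rpow (c := Real.log B) hβ).congr' ?_ Filter.EventuallyEq.rfl
  filter_upwards [Filter.eventually_ge_atTop 1] with L hL
  have hL0 : (0 : ℝ) < L := by exact_mod_cast hL
  have hlog : Real.log (B * (S : ℝ) ^ L) = Real.log S * L + Real.log B := by
    rw [Real.log_mul hB0.ne' (by positivity), Real.log_pow]
    ring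
  have hexp : Real.exp (Real.log S * L + ((2 * Real.log S)⁻¹ / L - 1) * Real.log L) =
      S * (S : ℝ) ^ (L - 1) * Real.exp ((2 * Real.log S)⁻¹ / L * Real.log L) / L := by
    rw [← pow_succ', Nat.sub_add_cancel hL, sub_mul, one_mul, ← add_sub_assoc, Real.exp_sub,
      Real.exp_add, Real.exp_log hL0, mul_comm (Real.log S), Real.exp_nat_mul,
      Real.exp_log (by linarith)]
  rw [hD L hL, hlog, hexp]
  have := Real.exp_pos ((2 * Real.log S)⁻¹ / L * Real.log L)
  generalize Real.exp ((2 * Real.log S)⁻¹ / L * Real.log L) = E at *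
  generalize (Real.log S * L + Real.log B) ^ (-1 + (2 * (Real.log S * L + Real.log B))⁻¹) = R
  field_simp

/-- `le_pow_of_isGreatest` is used directly instead of `D_L`, so that `z_L ≥ e` is not required and
every `L ≥ 1` is covered; `ln (S z_L)` is at most linear in `L`. -/
theorem exists_exp_le_dMin (hO : 2 ≤ O) (hS : 2 ≤ S) :
    ∃ c : ℝ, 0 < c ∧ ∀ L : ℕ, 1 ≤ L →
      ENNReal.ofReal (c * (Real.exp (Real.log S * L) / L)) ≤ (dMin L O S : ℝ≥0∞) := by
  have hS' : (2 : ℝ) ≤ S := by exact_mod_cast hS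
  have hu := two_le_outBase hO hS
  have hlu : 0 < Real.log (outBase O S) := Real.log_pos (by linarith)
  have hβ : 0 < Real.log S := Real.log_pos (by linarith)
  have hw : 0 ≤ Real.log (outBase O S * Real.log (outBase O S)) :=
    Real.log_nonneg (exp_one_le_zArg hO hS le_rfl).2
  set w := Real.log (outBase O S * Real.log (outBase O S)) with hw'
  refine ⟨Real.log (outBase O S) / (S * (Real.log S + w)), by positivity, fun L hL => ?_⟩
  obtain ⟨j, hj, hjL, h⟩ := exists_isGreatest_admissible (show 1 ≤ O by omega) hS hL
  refine ofReal_le_dMin (by omega) hS hj hjL h (le_trans ?_ (le_pow_of_isGreatest hO hS hL hj h))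
  have hL1 : (1 : ℝ) ≤ L := by exact_mod_cast hL
  have hX0 := (Real.exp_pos 1).trans_le (exp_one_le_zArg hO hS hL).1
  have hX : 0 < Real.log (S * zArg O S L) := by
    have := (Real.le_log_iff_exp_le hX0).mpr (exp_one_le_zArg hO hS hL).1
    linarith
  have hXle : Real.log (S * zArg O S L) ≤ (Real.log S + w) * L := by
    rw [zArg_eq (by omega) hS, Real.log_mul (by positivity) (by positivity), Real.log_pow, ← hw']
    nlinarith
  have hexp : Real.exp (Real.log S * L) = (S : ℝ) ^ (L - 1) * S := by
    rw [← pow_succ, Nat.sub_add_cancel hL, mul_comm, Real.exp_nat_mul, Real.exp_log (by linarith)]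
  calc Real.log (outBase O S) / (S * (Real.log S + w)) * (Real.exp (Real.log S * L) / L)
      = (S : ℝ) ^ (L - 1) * Real.log (outBase O S) / ((Real.log S + w) * L) := by
        rw [hexp]; field_simp
    _ ≤ _ := by gcongr

end TemporalCorr

theorem mainTheorem3 (O S : ℕ) (hO : 1 ≤ O) (hS : 2 ≤ S) :
    -- sequences of a fixed length `L`
    (∀ L : ℕ, 1 ≤ L →
      (∃ j : ℕ, 1 ≤ j ∧ j ≤ L ∧
        -- `j` is the largest integer with `S^(j-1) ≤ O^((S^(L-j+2) - S)/(S-1))`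
        IsGreatest {i : ℤ | (S : ℝ) ^ (i - 1) ≤
          (O : ℝ) ^ (((S : ℝ) ^ ((L : ℤ) - i + 2) - (S : ℝ)) / ((S : ℝ) - 1))} (j : ℤ) ∧
        (j : ℤ) = ⌊TemporalCorr.lambertW
              ((S : ℝ) ^ (L + 1) / ((S : ℝ) - 1) * Real.logb S O *
                (S : ℝ) ^ ((S : ℝ) / ((S : ℝ) - 1) * Real.logb S O) * Real.log S) / Real.log S
            - (S : ℝ) / ((S : ℝ) - 1) * Real.logb S O + 1⌋ ∧
        -- an extreme point whose time-step-`j` nodes have pairwise different futures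
        (∃ Γ : TemporalCorr.TupleTree O S,
          Γ.correlation L ∈ Set.extremePoints ℝ (TemporalCorr.aotPolytope L O S) ∧
          Γ.DistinctFuturesAt L j ∧
          TemporalCorr.minDim (Γ.correlation L) ≠ ⊤ ∧
          ((S ^ (j - 1) : ℕ) : ℕ∞) ≤ TemporalCorr.minDim (Γ.correlation L)) ∧
        ((S ^ (j - 1) : ℕ) : ℕ∞) ≤ TemporalCorr.dMin L O S) ∧
      -- the closed-form lower bound
      (Real.exp 1 ≤ TemporalCorr.zArg O S L →
        ∀ m : ℝ, (S : ℝ) ^ (m - 2) ≤ TemporalCorr.dimBound O S L →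
          ENNReal.ofReal ((S : ℝ) ^ (m - 2)) ≤ (TemporalCorr.dMin L O S : ℝ≥0∞))) ∧
    -- long sequences
    (2 ≤ O →
      (∃ A B α β γ δ : ℝ, 0 < A ∧ 0 < B ∧ 0 < α ∧ β = Real.log S ∧ γ = 1 ∧
        (∀ L : ℕ, 1 ≤ L → TemporalCorr.dimBound O S L =
          A * (S : ℝ) ^ (L - 1) * Real.log (B * (S : ℝ) ^ L) ^
            (-1 + (2 * Real.log (B * (S : ℝ) ^ L))⁻¹)) ∧
        (fun L : ℕ => TemporalCorr.dimBound O S L /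
            (α * Real.exp (β * L + (δ / L - γ) * Real.log L)) - 1)
          =O[Filter.atTop] (fun L : ℕ => 1 / (L : ℝ))) ∧
      (∃ c : ℝ, 0 < c ∧ ∀ L : ℕ, 1 ≤ L →
        ENNReal.ofReal (c * (Real.exp (Real.log S * L) / L)) ≤
          (TemporalCorr.dMin L O S : ℝ≥0∞))) := by
  refine ⟨fun L hL => ?_, fun hO2 => ⟨TemporalCorr.exists_dimBound_asymptotics hO2 hS,
    TemporalCorr.exists_exp_le_dMin hO2 hS⟩⟩
  obtain ⟨j, hj, hjL, h⟩ := TemporalCorr.exists_isGreatest_admissible hO hS hL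
  refine ⟨⟨j, hj, hjL, h, TemporalCorr.eq_floor_of_isGreatest hO hS hj h,
    TemporalCorr.exists_lower_bound hO hS hj hjL h,
    TemporalCorr.pow_le_dMin hO hS hj hjL h⟩, fun hz m hm => ?_⟩
  exact TemporalCorr.ofReal_le_dMin hO hS hj hjL h
    (hm.trans (TemporalCorr.dimBound_le_pow hO hS hL hj h hz))
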